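/- Let $(K,\preccurlyeq_K)$ be an abstract elementary class and let $\mathrm{LS}(K)$ be its Löwenheim–Skolem number, i.e. the least infinite cardinal $\mu$ such that every subset $A$ of a model $M\in K$ is contained in some $N\preccurlyeq_K M$ with $|N|\le |A|+\mu$. Let $M\in K$ with $|M|=\kappa>\mathrm{LS}(K)$ and $\kappa^{<\kappa}=\kappa$, and put $\mathcal K^{<}(M)=\{N : N\preccurlyeq_K M,\ |N|<\kappa\}$. For $X\subseteq M$ let $\mathrm{Aut}_X(M)$ be the group of automorphisms of $M$ fixing $X$ pointwise. Assume: (1) $M$ is homogeneous: every isomorphism $f:N_1\to N_2$ with $N_1,N_2\in\mathcal K^{<}(M)$ extends to an automorphism of $M$. (2) $\mathcal K^{<}(M)$ is a strong amalgamation class: for every index set $I$ with $|I|<\kappa$, all $N_0,N_1,N_2\in\mathcal K^{<}(M)$ with $N_0\preccurlyeq_K N_1$ and $N_0\preccurlyeq_K N_2$, every sequence $(g^0_i)_{i\in I}$ of automorphisms of $N_0$, and all sequences $(g^1_i)_{i\in I}$ of automorphisms of $N_1$ and $(g^2_i)_{i\in I}$ of automorphisms of $N_2$ with $g^1_i\restriction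 N_0=g^0_i=g^2_i\restriction N_0$ for all $i\in I$, there exist $N_3\in\mathcal K^{<}(M)$, $\alpha_1,\alpha_2\in\mathrm{Aut}_{N_0}(M)$ and automorphisms $(g^3_i)_{i\in I}$ of $N_3$ such that, for $\ell=1,2$, $\alpha_\ell[N_\ell]\preccurlyeq_K N_3$ and $g^3_i$ extends $\alpha_\ell\circ g^\ell_i\circ\alpha_\ell^{-1}\restriction\alpha_\ell[N_\ell]$ for all $i\in I$. For $A\subseteq M$ let $\mathrm{cl}^M(A)=\bigcap\{N : A\subseteq N\preccurlyeq_K M\}$, and let $\mathfrak T^{\mathrm{cl}}$ be the topology on $\mathrm{Aut}(M)$ generated by the cosets of the stabilisers $\mathrm{Aut}_{\mathrm{cl}^M(A)}(M)$, where $A\subseteq M$ and $|A|<\kappa$. Then every subgroup $H\le\mathrm{Aut}(M)$ with $[\mathrm{Aut}(M):H]\le\kappa$ is open in $\mathfrak T^{\mathrm{cl}}$, and there exists $A\in\mathcal K^{<}(M)$ with $\mathrm{Aut}_A(M)\le H$. In other words, $(\mathrm{Aut}(M),\mathfrak T^{\mathrm{cl}})$ has the small index property: every subgroup of index at most $\kappa$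 is open. -/

import Mathlib

open FirstOrder Cardinal Topology

universe u v w

/-- The automorphisms of an `L`-structure form a group under composition: `(f * g) x = f (g x)`. -/
instance FirstOrder.Language.Equiv.autGroup {L : FirstOrder.Language.{u, v}} {M : Type w} [L.Structure M] :
    Group (M ≃[L] M) where
  mul f g := f.comp g
  one := FirstOrder.Language.Equiv.refl L M
  inv f := f.symm
  mul_assoc _ _ _ := rfl
  one_mul _ := rfl
  mul_one _ := rfl
  inv_mul_cancel f := by
    ext x
    exact f.symm_apply_apply x

/-- For substructures `P ⊆ N` of `M`, the structure `P` regarded as a substructure of `N`. -/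
abbrev FirstOrder.Language.Substructure.within {L : FirstOrder.Language.{u, v}} {M : Type w} [L.Structure M]
    (P N : L.Substructure M) : L.Substructure N :=
  P.comap N.subtype.toHom

/-- An abstract elementary class of `L`-structures. The relation `≼` is only ever considered
between a structure `M` and a substructure `N` of it; `strong N` says `N ≼ M`. -/
structure AbstractElementaryClass (L : FirstOrder.Language.{u, v}) where
  /-- `mem M`: the structure `M` belongs to the class. -/
  mem : ∀ (M : Type w) [L.Structure M], Prop
  /-- `strong N`, for a substructure `N` of `M`: the relation `N ≼ M`. -/
  strong : ∀ {M : Type w} [L.Structure M], L.Substructure M → Prop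
  /-- The relation `≼` holds between members of the class only. -/
  mem_of_strong : ∀ {M : Type w} [L.Structure M] (N : L.Substructure M),
    strong N → mem N ∧ mem M
  /-- The class is closed under isomorphism. -/
  mem_iso : ∀ {M M' : Type w} [L.Structure M] [L.Structure M'], (M ≃[L] M') → mem M → mem M'
  /-- The relation `≼` is closed under isomorphism. -/
  strong_iso : ∀ {M M' : Type w} [L.Structure M] [L.Structure M'] (f : M ≃[L] M')
    (N : L.Substructure M), strong N → strong (N.map f.toHom)
  /-- Reflexivity: `M ≼ M`. -/
  strong_refl : ∀ {M : Type w} [L.Structure M], mem M → strong (⊤ : L.Substructure M)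
  /-- Transitivity: `P ≼ N ≼ M` implies `P ≼ M`. -/
  strong_trans : ∀ {M : Type w} [L.Structure M] (P N : L.Substructure M),
    P ≤ N → strong (P.within N) → strong N → strong P
  /-- Coherence: if `P ⊆ N`, `P ≼ M` and `N ≼ M`, then `P ≼ N`. -/
  coherence : ∀ {M : Type w} [L.Structure M] (P N : L.Substructure M),
    P ≤ N → strong P → strong N → strong (P.within N)
  /-- If `U` is the union of a `≼`-increasing (well-ordered) chain, then `U` belongs to the class
  and each member of the chain is a strong substructure of `U`. -/
  chain_union : ∀ {U : Type w} [L.Structure U] {ι : Type w} [LinearOrder ι] [WellFoundedLT ι]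
    [Nonempty ι] (N : ι → L.Substructure U), Monotone N →
    (∀ i j, i ≤ j → strong ((N i).within (N j))) → (∀ x : U, ∃ i, x ∈ N i) →
    mem U ∧ ∀ i, strong (N i)
  /-- Smoothness: the union of an increasing (well-ordered) chain of strong substructures of `M`
  is a strong substructure of `M`. -/
  chain_smooth : ∀ {M : Type w} [L.Structure M] {ι : Type w} [LinearOrder ι] [WellFoundedLT ι]
    [Nonempty ι] (N : ι → L.Substructure M), Monotone N → (∀ i, strong (N i)) →
    ∀ S : L.Substructure M, (S : Set M) = ⋃ i, (N i : Set M) → strong S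
  /-- The Löwenheim–Skolem axiom. -/
  exists_ls : ∃ μ : Cardinal.{w}, ℵ₀ ≤ μ ∧ ∀ {M : Type w} [L.Structure M], mem M →
    ∀ A : Set M, ∃ N : L.Substructure M, strong N ∧ A ⊆ N ∧ #N ≤ #A + μ

namespace AbstractElementaryClass

variable {L : FirstOrder.Language.{u, v}} (K : AbstractElementaryClass.{u, v, w} L)

/-- The Löwenheim–Skolem number `LS(K)`: the least infinite cardinal `μ` such that every subset `A`
of a member `M` is contained in some `N ≼ M` of cardinality at most `|A| + μ`. (Some authors
also ask for `|L| ≤ μ`, which could only make the number larger.) -/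
noncomputable def lsNumber : Cardinal.{w} :=
  sInf {μ : Cardinal.{w} | ℵ₀ ≤ μ ∧ ∀ {M : Type w} [L.Structure M], K.mem M →
    ∀ A : Set M, ∃ N : L.Substructure M, K.strong N ∧ A ⊆ N ∧ #N ≤ #A + μ}

variable {M : Type w} [L.Structure M]

/-- The relation `P ≼ N` between two substructures of `M`. -/
def StrongIn (P N : L.Substructure M) : Prop :=
  P ≤ N ∧ K.strong (P.within N)

variable (M) in
/-- The family `K^<(M)` of small strong submodels of `M`, small meaning of size less than `|M|`. -/
def smallStrong : Set (L.Substructure M) :=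
  {N | K.strong N ∧ #N < #M}

variable (M) in
/-- Homogeneity of `M`: every isomorphism between small strong submodels of `M` extends to an
automorphism of `M`. -/
def IsHomogeneousModel : Prop :=
  ∀ N₁ ∈ K.smallStrong M, ∀ N₂ ∈ K.smallStrong M, ∀ f : N₁ ≃[L] N₂,
    ∃ g : M ≃[L] M, ∀ x : N₁, g x = f x

end AbstractElementaryClass

/-- The pointwise stabiliser `Aut_X(M)` of a subset `X` of `M`. -/
def FirstOrder.Language.autFixing (L : FirstOrder.Language.{u, v}) {M : Type w} [L.Structure M] (X : Set M) :
    Subgroup (M ≃[L] M) where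
  carrier := {g | ∀ x ∈ X, g x = x}
  mul_mem' {f g} hf hg x hx := by
    change f (g x) = x
    rw [hg x hx, hf x hx]
  one_mem' _ _ := rfl
  inv_mem' {f} hf x hx := by
    change f.symm x = x
    conv_lhs => rw [← hf x hx]
    exact f.symm_apply_apply x

namespace AbstractElementaryClass

variable {L : FirstOrder.Language.{u, v}} (K : AbstractElementaryClass.{u, v, w} L)
variable {M : Type w} [L.Structure M]

/-- A sequence `γ'` of automorphisms of `N` extends a sequence `γ` of automorphisms of `N₀`. -/
def SeqExtends {I : Type w} {N₀ N : L.Substructure M} (γ' : I → (N ≃[L] N))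
    (γ : I → (N₀ ≃[L] N₀)) : Prop :=
  N₀ ≤ N ∧ ∀ (i : I) (x : N₀) (y : N), (y : M) = x → (γ' i y : M) = γ i x

/-- Sequences `γ₁`, `γ₂` of automorphisms of `N₁`, `N₂` are compatible over `N₀`: there are
`N₃ ∈ K^<(M)`, automorphisms `α₁`, `α₂` of `M` fixing `N₀` pointwise with `α₁[N₁], α₂[N₂] ≼ N₃`,
and a sequence `γ₃` of automorphisms of `N₃` extending `α₁ ∘ γ₁ ∘ α₁⁻¹` on `α₁[N₁]` and
`α₂ ∘ γ₂ ∘ α₂⁻¹` on `α₂[N₂]`. -/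
def Compatible {I : Type w} (N₀ : L.Substructure M) {N₁ N₂ : L.Substructure M}
    (γ₁ : I → (N₁ ≃[L] N₁)) (γ₂ : I → (N₂ ≃[L] N₂)) : Prop :=
  ∃ N₃ ∈ K.smallStrong M, ∃ α₁ ∈ L.autFixing (N₀ : Set M), ∃ α₂ ∈ L.autFixing (N₀ : Set M),
    K.StrongIn (N₁.map α₁.toHom) N₃ ∧ K.StrongIn (N₂.map α₂.toHom) N₃ ∧
    ∃ γ₃ : I → (N₃ ≃[L] N₃),
      (∀ (i : I) (x : N₁) (y : N₃), (y : M) = α₁ x → (γ₃ i y : M) = α₁ (γ₁ i x)) ∧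
      (∀ (i : I) (x : N₂) (y : N₃), (y : M) = α₂ x → (γ₃ i y : M) = α₂ (γ₂ i x))

/-- `(N₀, γ₀)` is a strong amalgamation base: any two sequences of automorphisms of strong
extensions of `N₀` in `K^<(M)` which extend `γ₀` are compatible over `N₀`. -/
def IsStrongAmalgamationBase {I : Type w} (N₀ : L.Substructure M) (γ₀ : I → (N₀ ≃[L] N₀)) : Prop :=
  ∀ N₁ ∈ K.smallStrong M, ∀ N₂ ∈ K.smallStrong M, K.StrongIn N₀ N₁ → K.StrongIn N₀ N₂ →
    ∀ (γ₁ : I → (N₁ ≃[L] N₁)) (γ₂ : I → (N₂ ≃[L] N₂)),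
      SeqExtends γ₁ γ₀ → SeqExtends γ₂ γ₀ → K.Compatible N₀ γ₁ γ₂

variable (M) in
/-- `K^<(M)` is a strong amalgamation class: every pair of a model in `K^<(M)` and a sequence of
fewer than `|M|` automorphisms of it is a strong amalgamation base. -/
def IsStrongAmalgamationClass : Prop :=
  ∀ I : Type w, #I < #M → ∀ N ∈ K.smallStrong M, ∀ γ : I → (N ≃[L] N),
    K.IsStrongAmalgamationBase N γ

/-- The closure `cl^M(A)`: the intersection of all `N ≼ M` containing `A`. -/
def cl (A : Set M) : Set M :=
  {x | ∀ N : L.Substructure M, K.strong N → A ⊆ N → x ∈ N}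

variable (M) in
/-- The closure topology on `Aut(M)`: the topology generated by the cosets of the stabilisers
`Aut_X(M)`, where `X` is the closure of a subset of size less than `|M|`. (The family of left
cosets and that of right cosets coincide, as `g Aut_X(M) = Aut_{g[X]}(M) g`.) -/
abbrev closureTopology : TopologicalSpace (M ≃[L] M) :=
  TopologicalSpace.generateFrom
    {U | ∃ A : Set M, #A < #M ∧ ∃ g : M ≃[L] M,
      U = {h | ∃ s ∈ L.autFixing (K.cl A), h = g * s}}

variable (M) in
/-- The small index property of `Aut(M)` with the closure topology: every subgroup of index at
most `|M|` is open. -/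
def HasSmallIndexProperty : Prop :=
  ∀ H : Subgroup (M ≃[L] M), #((M ≃[L] M) ⧸ H) ≤ #M →
    IsOpen[K.closureTopology M] (H : Set (M ≃[L] M))

end AbstractElementaryClass

/-! Write κ = |M| and G = Aut(M), and suppose that `H` has index at most κ but contains the
pointwise stabiliser of no small strong submodel. Let `c` list elements of G so that every
automorphism lies in some `c i` H. A diagonal argument yields x_i ∈ H, y_i ∉ `c i` H (`c i`)⁻¹ and a
single `f` with f x_i f⁻¹ = y_i for all i < κ. For an i with f ∈ `c i` H this is absurd.

The automorphism `f` comes from a back-and-forth of length κ. It needs the tuples of the x_j and of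
the y_j, j ≤ i, to be generic, i.e. to realise every small extension of their restriction to an
invariant small submodel; a partial intertwiner of two generic tuples then extends
(`exists_extend_intertwiner_both`). New entries act trivially on the part of `M` already treated, so
the partial `f` stays an intertwiner when they are added.

The entries have the form x_i = g_i r and y_i = g_i r'. Since the index is at most κ and κ^{<κ} = κ,
a set `R` of at most κ translations serves all demands on x_i and y_i (`exists_translators`). As `R`
is fixed before the g_i, strong amalgamation with bookkeeping of κ tasks makes each initial segment
of the g_i generic under every choice of translations from `R` (`exists_generic_family`).
`AmalgamationSystem` isolates what this requires; Löwenheim–Skolem, smoothness, homogeneity and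
strong amalgamation supply it. -/

open scoped Pointwise

/-! ### Transfinite recursion with choices -/

/-- Transfinite dependent choice along a well-order: if every coherent family of choices below `i`
can be continued at `i`, then there is a coherent choice everywhere. -/
theorem exists_transfinite_choice {W S : Type*} [LinearOrder W] [WellFoundedLT W] [Nonempty S]
    (R : ∀ i : W, (Set.Iio i → S) → S → Prop)
    (h : ∀ (i : W) (F : Set.Iio i → S),
      (∀ j : Set.Iio i, R j (fun l => F ⟨l, lt_trans l.2 j.2⟩) (F j)) → ∃ s, R i F s) :
    ∃ F : W → S, ∀ i, R i (fun j => F j) (F i) := by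
  classical
  -- The default only makes the recursion total; the induction below shows that it is never taken.
  let F : W → S := (wellFounded_lt (α := W)).fix fun i G =>
    if hs : ∃ s, R i (fun j => G j j.2) s then hs.choose else Classical.arbitrary S
  have hF : ∀ i, F i = if hs : ∃ s, R i (fun j => F j) s then hs.choose
      else Classical.arbitrary S := fun i => WellFounded.fix_eq _ _ i
  refine ⟨F, fun i => ?_⟩
  induction i using (wellFounded_lt (α := W)).induction with
  | _ i ih =>
    have hs : ∃ s, R i (fun j => F j) s := h i _ fun j => ih j j.2
    rw [hF i, dif_pos hs]
    exact hs.choose_spec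

/-! ### Amalgamation systems and generic tuples -/

/-- A family `𝒦` of small subsets of a `G`-set `M`, closed under translation, unions of short chains
and gluing of chains of partial maps, in which tuples of partial maps can be amalgamated. -/
structure AmalgamationSystem (G : Type w) {M : Type w} [Group G] [MulAction G M]
    (𝒦 : Set (Set M)) : Prop where
  small : ∀ N ∈ 𝒦, #N < #M
  smul_mem : ∀ (g : G), ∀ N ∈ 𝒦, g • N ∈ 𝒦
  exists_superset : ∀ A : Set M, #A < #M → ∃ N ∈ 𝒦, A ⊆ N
  iUnion_mem : ∀ {ι : Type w} [LinearOrder ι] [WellFoundedLT ι] [Nonempty ι] (N : ι → Set M),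
    #ι < #M → Monotone N → (∀ i, N i ∈ 𝒦) → ⋃ i, N i ∈ 𝒦
  glue : ∀ {ι : Type w} [LinearOrder ι] [WellFoundedLT ι] [Nonempty ι] (N : ι → Set M)
    (f : ι → G), Monotone N → (∀ i, N i ∈ 𝒦) →
    (∀ i j, i ≤ j → ∀ x ∈ N i, f j • x = f i • x) →
    (#ι < #M ∨ (∀ x, ∃ i, x ∈ N i) ∧ ∀ x, ∃ i, x ∈ f i • N i) →
    ∃ g : G, ∀ i, ∀ x ∈ N i, g • x = f i • x
  amalgamate : ∀ {I : Type w}, #I < #M → ∀ N₀ ∈ 𝒦, ∀ N₁ ∈ 𝒦, ∀ N₂ ∈ 𝒦, N₀ ⊆ N₁ → N₀ ⊆ N₂ →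
    ∀ γ₁ γ₂ : I → G, (∀ i, γ₁ i • N₀ = N₀) → (∀ i, γ₁ i • N₁ = N₁) → (∀ i, γ₂ i • N₂ = N₂) →
    (∀ i, ∀ x ∈ N₀, γ₂ i • x = γ₁ i • x) →
    ∃ N₃ ∈ 𝒦, ∃ (α : G) (γ₃ : I → G), N₁ ⊆ N₃ ∧ α • N₂ ⊆ N₃ ∧ (∀ x ∈ N₀, α • x = x) ∧
      (∀ i, ∀ x ∈ N₁, γ₃ i • x = γ₁ i • x) ∧ ∀ i, ∀ x ∈ N₂, γ₃ i • α • x = α • γ₂ i • x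

/-- A tuple `γ` of elements of `G` is generic for `𝒦` if every extension, by a tuple `η`, of its
restriction to an invariant `N₀ ∈ 𝒦` is realised in `γ` up to translation over `N₀`. -/
def IsGenericTuple {G M I : Type*} [Group G] [MulAction G M] (𝒦 : Set (Set M)) (γ : I → G) :
    Prop :=
  ∀ N₀ ∈ 𝒦, ∀ N₁ ∈ 𝒦, N₀ ⊆ N₁ → (∀ i, γ i • N₀ = N₀) → ∀ η : I → G, (∀ i, η i • N₁ = N₁) →
    (∀ i, ∀ x ∈ N₀, η i • x = γ i • x) →
    ∃ α : G, (∀ x ∈ N₀, α • x = x) ∧ ∀ i, ∀ x ∈ N₁, γ i • α • x = α • η i • x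

/-! ### Back-and-forth between generic tuples -/

namespace AmalgamationSystem

variable {G M : Type w} [Group G] [MulAction G M] {𝒦 : Set (Set M)}

/-- Every small set is contained in a member of the system invariant under a given small family. -/
theorem exists_invariant_superset (h𝒦 : AmalgamationSystem G 𝒦) (hM : ℵ₀ < #M) {A : Set M}
    (hA : #A < #M) {I : Type w} (hI : #I < #M) (γ : I → G) :
    ∃ N ∈ 𝒦, A ⊆ N ∧ ∀ i, γ i • N = N := by
  have step : ∀ N : Set M, #N < #M → ∃ N' ∈ 𝒦, N ⊆ N' ∧ ∀ i, γ i • N ⊆ N' ∧ (γ i)⁻¹ • N ⊆ N' := by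
    intro N hN
    have hsmall : #(N ∪ Set.range (fun p : I × N => γ p.1 • (p.2 : M)) ∪
        Set.range (fun p : I × N => (γ p.1)⁻¹ • (p.2 : M)) : Set M) < #M := by
      have hp : #(I × N) < #M := by
        rw [mk_prod, lift_id, lift_id]; exact mul_lt_of_lt hM.le hI hN
      refine (mk_union_le _ _).trans_lt (add_lt_of_lt hM.le ?_ (mk_range_le.trans_lt hp))
      exact (mk_union_le _ _).trans_lt (add_lt_of_lt hM.le hN (mk_range_le.trans_lt hp))
    obtain ⟨N', hN', hsub⟩ := h𝒦.exists_superset _ hsmall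
    refine ⟨N', hN', fun x hx => hsub (Or.inl (Or.inl hx)), fun i => ⟨?_, ?_⟩⟩
    · rintro _ ⟨x, hx, rfl⟩
      exact hsub (Or.inl (Or.inr ⟨(i, ⟨x, hx⟩), rfl⟩))
    · rintro _ ⟨x, hx, rfl⟩
      exact hsub (Or.inr ⟨(i, ⟨x, hx⟩), rfl⟩)
  obtain ⟨N₀, hN₀, hAN₀⟩ := h𝒦.exists_superset A hA
  choose! next hnext using step
  -- Closing off ω times gives invariance; the union stays in `𝒦` because ℵ₀ < |M|.
  let N : ℕ → Set M := fun n => next^[n] N₀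
  have hN : ∀ n, N n ∈ 𝒦 := by
    intro n
    induction n with
    | zero => exact hN₀
    | succ n ih =>
      simp only [N, Function.iterate_succ_apply']
      exact (hnext _ (h𝒦.small _ ih)).1
  have hsucc : ∀ n, N (n + 1) = next (N n) := fun n => Function.iterate_succ_apply' _ _ _
  have hmono : Monotone N := monotone_nat_of_le_succ fun n => by
    rw [hsucc]; exact (hnext _ (h𝒦.small _ (hN n))).2.1
  have hwf : WellFoundedLT (ULift.{w} ℕ) :=
    ⟨InvImage.wf ULift.down (wellFounded_lt (α := ℕ))⟩
  have hU := h𝒦.iUnion_mem (ι := ULift.{w} ℕ) (fun n => N n.down) (by simpa using hM)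
    (fun a b hab => hmono hab) fun n => hN _
  refine ⟨_, hU, fun x hx => Set.mem_iUnion.2 ⟨⟨0⟩, hAN₀ hx⟩, fun i => ?_⟩
  have hstep : ∀ n, γ i • N n ⊆ N (n + 1) ∧ (γ i)⁻¹ • N n ⊆ N (n + 1) := fun n => by
    rw [hsucc]; exact (hnext _ (h𝒦.small _ (hN n))).2.2 i
  apply Set.Subset.antisymm
  · rintro _ ⟨x, hx, rfl⟩
    obtain ⟨n, hn⟩ := Set.mem_iUnion.1 hx
    exact Set.mem_iUnion.2 ⟨⟨n.down + 1⟩, (hstep _).1 ⟨x, hn, rfl⟩⟩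
  · intro x hx
    obtain ⟨n, hn⟩ := Set.mem_iUnion.1 hx
    rw [Set.mem_smul_set_iff_inv_smul_mem]
    exact Set.mem_iUnion.2 ⟨⟨n.down + 1⟩, (hstep _).2 ⟨x, hn, rfl⟩⟩

/-- An intertwiner between two generic tuples on an invariant member of the system extends to one
whose domain contains a given small set. -/
theorem exists_extend_intertwiner (h𝒦 : AmalgamationSystem G 𝒦) (hM : ℵ₀ < #M) {I : Type w}
    (hI : #I < #M) {γ δ : I → G} (hδ : IsGenericTuple 𝒦 δ) {N₀ : Set M} (hN₀ : N₀ ∈ 𝒦)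
    (hγN₀ : ∀ i, γ i • N₀ = N₀) {f : G} (hf : ∀ i, ∀ x ∈ N₀, f • γ i • x = δ i • f • x)
    {A : Set M} (hA : #A < #M) :
    ∃ N ∈ 𝒦, N₀ ⊆ N ∧ A ⊆ N ∧ (∀ i, γ i • N = N) ∧
      ∃ g : G, (∀ x ∈ N₀, g • x = f • x) ∧ ∀ i, ∀ x ∈ N, g • γ i • x = δ i • g • x := by
  obtain ⟨N, hN, hsub, hγN⟩ := h𝒦.exists_invariant_superset hM (A := N₀ ∪ A)
    ((mk_union_le _ _).trans_lt (add_lt_of_lt hM.le (h𝒦.small _ hN₀) hA)) hI γ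
  have hN₀N : N₀ ⊆ N := fun x hx => hsub (Or.inl hx)
  have hconj : ∀ i (x : M), (f * γ i * f⁻¹) • f • x = f • γ i • x := fun i x => by
    simp [mul_smul]
  -- Transported by `f`, the tuple `γ` on `N` becomes an extension of `δ` restricted to `f • N₀`.
  -- Genericity of `δ` realises it by some `α`, and `α * f` is the extended intertwiner.
  obtain ⟨α, hα₀, hα⟩ := hδ (f • N₀) (h𝒦.smul_mem f _ hN₀) (f • N) (h𝒦.smul_mem f _ hN)
    (Set.smul_set_mono hN₀N) (fun i => by
      have : δ i • f • N₀ = f • γ i • N₀ := by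
        ext y
        constructor
        · rintro ⟨_, ⟨x, hx, rfl⟩, rfl⟩
          exact ⟨_, ⟨x, hx, rfl⟩, hf i x hx⟩
        · rintro ⟨_, ⟨x, hx, rfl⟩, rfl⟩
          exact ⟨_, ⟨x, hx, rfl⟩, (hf i x hx).symm⟩
      rw [this, hγN₀])
    (fun i => f * γ i * f⁻¹) (fun i => by
      rw [mul_smul, mul_smul, inv_smul_smul, hγN])
    (fun i => by
      rintro _ ⟨x, hx, rfl⟩
      exact (hconj i x).trans (hf i x hx))
  refine ⟨N, hN, hN₀N, fun x hx => hsub (Or.inr hx), hγN, α * f, fun x hx => ?_, fun i x hx => ?_⟩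
  · rw [mul_smul, hα₀ _ ⟨x, hx, rfl⟩]
  · rw [mul_smul, mul_smul, ← hconj i x]
    exact (hα i _ ⟨x, hx, rfl⟩).symm

/-- Two-sided version of `exists_extend_intertwiner`. -/
theorem exists_extend_intertwiner_both (h𝒦 : AmalgamationSystem G 𝒦) (hM : ℵ₀ < #M) {I : Type w}
    (hI : #I < #M) {γ δ : I → G} (hγ : IsGenericTuple 𝒦 γ) (hδ : IsGenericTuple 𝒦 δ)
    {N₀ : Set M} (hN₀ : N₀ ∈ 𝒦) (hγN₀ : ∀ i, γ i • N₀ = N₀) {f : G}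
    (hf : ∀ i, ∀ x ∈ N₀, f • γ i • x = δ i • f • x) (m : M) :
    ∃ N ∈ 𝒦, N₀ ⊆ N ∧ m ∈ N ∧ (∀ i, γ i • N = N) ∧
      ∃ g : G, m ∈ g • N ∧ (∀ x ∈ N₀, g • x = f • x) ∧
        ∀ i, ∀ x ∈ N, g • γ i • x = δ i • g • x := by
  have hm : #({m} : Set M) < #M := by
    rw [mk_singleton]; exact one_lt_aleph0.trans hM
  obtain ⟨N, hN, hN₀N, hmN, hγN, g, hg₀, hg⟩ :=
    h𝒦.exists_extend_intertwiner hM hI hδ hN₀ hγN₀ hf hm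
  have hδN : ∀ i, δ i • g • N = g • N := fun i => by
    have : δ i • g • N = g • γ i • N := by
      ext y
      constructor
      · rintro ⟨_, ⟨x, hx, rfl⟩, rfl⟩
        exact ⟨_, ⟨x, hx, rfl⟩, hg i x hx⟩
      · rintro ⟨_, ⟨x, hx, rfl⟩, rfl⟩
        exact ⟨_, ⟨x, hx, rfl⟩, (hg i x hx).symm⟩
    rw [this, hγN]
  -- The "back" half: the same extension applied to `g⁻¹`, with the tuples exchanged. The final
  -- intertwiner is the inverse of its result.
  obtain ⟨N', hN', hsub, hmN', hδN', k, hk₀, hk⟩ :=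
    h𝒦.exists_extend_intertwiner (f := g⁻¹) hM hI hγ (h𝒦.smul_mem g _ hN) hδN (by
      rintro i _ ⟨x, hx, rfl⟩
      simp only [inv_smul_smul]
      rw [inv_smul_eq_iff, hg i x hx]) hm
  have hkg : ∀ x ∈ N, k • g • x = x := fun x hx => by
    rw [hk₀ _ ⟨x, hx, rfl⟩, inv_smul_smul]
  have hNk : N ⊆ k • N' := fun x hx => ⟨g • x, hsub ⟨x, hx, rfl⟩, hkg x hx⟩
  refine ⟨k • N', h𝒦.smul_mem k _ hN', hN₀N.trans hNk, hNk (hmN rfl), fun i => ?_, k⁻¹,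
    by rw [inv_smul_smul]; exact hmN' rfl, fun x hx => ?_, ?_⟩
  · have : γ i • k • N' = k • δ i • N' := by
      ext y
      constructor
      · rintro ⟨_, ⟨x, hx, rfl⟩, rfl⟩
        exact ⟨_, ⟨x, hx, rfl⟩, hk i x hx⟩
      · rintro ⟨_, ⟨x, hx, rfl⟩, rfl⟩
        exact ⟨_, ⟨x, hx, rfl⟩, (hk i x hx).symm⟩
    rw [this, hδN']
  · rw [inv_smul_eq_iff, ← hg₀ x hx, hkg x (hN₀N hx)]
  · rintro i _ ⟨x, hx, rfl⟩
    simp only [inv_smul_smul]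
    rw [inv_smul_eq_iff, hk i x hx]

/-- Coherent partial maps on a short, possibly empty, chain in the system have common extensions, on
a member of the system which is the union of the chain if the chain is nonempty. -/
theorem exists_glue_below (h𝒦 : AmalgamationSystem G 𝒦) {ι : Type w} [LinearOrder ι]
    [WellFoundedLT ι] (hι : #ι < #M) {T : Type*} {N : ι → Set M} {f : ι → T → G}
    (hN : ∀ i, N i ∈ 𝒦) (hmono : Monotone N)
    (hf : ∀ i j, i ≤ j → ∀ t, ∀ x ∈ N i, f j t • x = f i t • x) :
    ∃ P ∈ 𝒦, (∀ i, N i ⊆ P) ∧ (∀ i, ∀ x ∈ P, ∃ j, i ≤ j ∧ x ∈ N j) ∧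
      ∃ g : T → G, ∀ i t, ∀ x ∈ N i, g t • x = f i t • x := by
  rcases isEmpty_or_nonempty ι with hemp | hne
  · obtain ⟨P, hP, -⟩ := h𝒦.exists_superset ∅ (by
      simpa using bot_lt_of_lt hι)
    exact ⟨P, hP, fun i => isEmptyElim i, fun i => isEmptyElim i, fun _ => 1,
      fun i => isEmptyElim i⟩
  · have hg := fun t => h𝒦.glue N (fun i => f i t) hmono hN (fun i j hij => hf i j hij t)
      (Or.inl hι)
    choose g hg using hg
    refine ⟨_, h𝒦.iUnion_mem N hι hmono hN, Set.subset_iUnion N, fun i x hx => ?_, g,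
      fun i t => hg t i⟩
    obtain ⟨j, hj⟩ := Set.mem_iUnion.1 hx
    exact ⟨max i j, le_max_left _ _, hmono (le_max_right _ _) hj⟩

end AmalgamationSystem

/-! ### Cardinal arithmetic under κ^{<κ} = κ -/

theorem Cardinal.mk_sigma_le_of_le {ι : Type w} {X : ι → Type w} {c : Cardinal.{w}} (hc : ℵ₀ ≤ c)
    (hι : #ι ≤ c) (hX : ∀ i, #(X i) ≤ c) : #(Σ i, X i) ≤ c := by
  rw [mk_sigma]
  refine (sum_le_mk_mul_iSup _).trans (mul_le_of_le hc hι (ciSup_le' hX))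

theorem Cardinal.mk_prod_le_of_le {X Y : Type w} {c : Cardinal.{w}} (hc : ℵ₀ ≤ c)
    (hX : #X ≤ c) (hY : #Y ≤ c) : #(X × Y) ≤ c := by
  rw [mk_prod, lift_id, lift_id]
  exact mul_le_of_le hc hX hY

theorem Cardinal.mk_arrow_le_of_powerlt {X Y : Type w} {c : Cardinal.{w}} (hc : c ^< c = c)
    (hX : #X < c) (hY : #Y ≤ c) : #(X → Y) ≤ c := by
  rw [← power_def]
  exact (power_le_power_right hY).trans ((le_powerlt c hX).trans hc.le)

/-- By König's theorem `c` is less than `c` to the power of its cofinality, which a singular `c`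
would bound by `c ^< c`. -/
theorem Cardinal.isRegular_of_powerlt_self {c : Cardinal.{w}} (h : ℵ₀ ≤ c) (hc : c ^< c = c) :
    c.IsRegular := by
  refine ⟨h, not_lt.1 fun hlt => ?_⟩
  exact ((lt_power_cof_ord h).trans_le ((le_powerlt c hlt).trans hc.le)).false

/-- If `c ^< c = c` then a set of size `c` has only `c` subsets of size less than `c`. -/
theorem Cardinal.mk_small_subsets_le {X : Type w} (h : ℵ₀ ≤ #X) (hc : #X ^< #X = #X) :
    #{A : Set X // #A < #X} ≤ #X := by
  obtain ⟨_, _, hX⟩ := exists_ord_eq_type_lt X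
  let F : (Σ i : X, Set.Iio i → X) → Set X := fun p => Set.range p.2
  have hsub : {A : Set X | #A < #X} ⊆ insert ∅ (Set.range F) := by
    intro A hA
    rcases A.eq_empty_or_nonempty with rfl | hne
    · exact Or.inl rfl
    right
    have hlt : (#A).ord < Ordinal.type (α := X) (· < ·) := by
      rw [← hX]; exact ord_lt_ord.2 hA
    -- In a well-order of type `(#X).ord`, the point at position `(#A).ord` has exactly `#A`
    -- predecessors, so `A` is the range of a function on them.
    let i : X := Ordinal.enum (α := X) (· < ·) ⟨(#A).ord, hlt⟩
    have hi : #(Set.Iio i) = #A := by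
      have := congrArg Ordinal.card (Ordinal.typein_enum (α := X) (· < ·) hlt)
      rw [card_ord] at this
      exact this
    obtain ⟨e⟩ := Cardinal.eq.1 hi
    refine ⟨⟨i, fun j => (e j : X)⟩, ?_⟩
    ext x
    exact ⟨fun ⟨j, hj⟩ => hj ▸ (e j).2, fun hx => ⟨e.symm ⟨x, hx⟩, by simp⟩⟩
  refine (mk_le_mk_of_subset hsub).trans ((mk_insert_le).trans ?_)
  refine add_le_of_le h (mk_range_le.trans ?_) (one_le_aleph0.trans h)
  exact mk_sigma_le_of_le h le_rfl fun i => mk_arrow_le_of_powerlt hc (mk_Iio_lt i hX) le_rfl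

/-! ### Construction of generic families -/

namespace AmalgamationSystem

variable {G M : Type w} [Group G] [MulAction G M] {𝒦 : Set (Set M)}

theorem mk_le (h𝒦 : AmalgamationSystem G 𝒦) (hM : ℵ₀ < #M) (hpow : #M ^< #M = #M) :
    #𝒦 ≤ #M :=
  (mk_le_mk_of_subset (t := {A : Set M | #A < #M}) fun N hN => h𝒦.small N hN).trans
    (mk_small_subsets_le hM.le hpow)

/-- There is a set of at most `#M` elements of `G` realising all restrictions of elements of `G` to
members of the system. -/
theorem exists_dense_subset (h𝒦 : AmalgamationSystem G 𝒦) (hM : ℵ₀ < #M)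
    (hpow : #M ^< #M = #M) :
    ∃ S : Set G, #S ≤ #M ∧ ∀ N ∈ 𝒦, ∀ g : G, ∃ s ∈ S, ∀ x ∈ N, s • x = g • x := by
  classical
  let F : (Σ N : 𝒦, (↥(N : Set M) → M)) → G := fun p =>
    if h : ∃ g : G, ∀ x : (p.1 : Set M), g • (x : M) = p.2 x then h.choose else 1
  refine ⟨Set.range F, mk_range_le.trans (mk_sigma_le_of_le hM.le (h𝒦.mk_le hM hpow) fun N =>
    mk_arrow_le_of_powerlt hpow (h𝒦.small _ N.2) le_rfl), fun N hN g => ?_⟩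
  have h : ∃ g' : G, ∀ x : N, g' • (x : M) = g • (x : M) := ⟨g, fun _ => rfl⟩
  refine ⟨_, ⟨⟨⟨N, hN⟩, fun x => g • (x : M)⟩, rfl⟩, fun x hx => ?_⟩
  simp only [F]
  rw [dif_pos h]
  exact h.choose_spec ⟨x, hx⟩

/-- One step in the construction of a generic family: a small approximation `(P, u)` extends to
`(N, u')` deciding whether `(N₀, N₁, s)` is an extension problem for the tuple `(u' t * r t)`, and
solving it in that case. -/
theorem exists_generic_step (h𝒦 : AmalgamationSystem G 𝒦) (hM : ℵ₀ < #M) {W : Type w}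
    {P : Set M} (hP : P ∈ 𝒦) (u : W → G) (m : M) {A B : Set W} (hA : #A < #M) (hB : #B < #M)
    (r s : B → G) {N₀ N₁ : Set M} (hN₀ : N₀ ∈ 𝒦) (hN₁ : N₁ ∈ 𝒦) :
    ∃ N ∈ 𝒦, ∃ u' : W → G, P ⊆ N ∧ m ∈ N ∧ (∀ t, ∀ x ∈ P, u' t • x = u t • x) ∧
      (∀ t ∈ A, u' t • N = N) ∧ (∀ t, r t • N₀ ⊆ N) ∧
      (N₀ ⊆ N₁ → (∀ t : B, (u' t * r t) • N₀ = N₀) → (∀ t, s t • N₁ = N₁) →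
        (∀ t : B, ∀ x ∈ N₀, s t • x = (u' t * r t) • x) →
        ∃ α : G, (∀ x ∈ N₀, α • x = x) ∧
          ∀ t : B, ∀ x ∈ N₁, r t • α • x ∈ N ∧ (u' t * r t) • α • x = α • s t • x) := by
  classical
  have hsum : ∀ {X Y : Type w}, #X < #M → #Y < #M → #(X ⊕ Y) < #M := fun hX hY => by
    rw [mk_sum, lift_id, lift_id]; exact add_lt_of_lt hM.le hX hY
  have hunion : ∀ {X Y : Set M}, #X < #M → #Y < #M → #(X ∪ Y : Set M) < #M := fun hX hY =>
    (mk_union_le _ _).trans_lt (add_lt_of_lt hM.le hX hY)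
  have hm : #({m} : Set M) < #M := by
    rw [mk_singleton]; exact one_lt_aleph0.trans hM
  obtain ⟨N', hN', hsub, hinv⟩ := h𝒦.exists_invariant_superset hM (A := P ∪ N₀ ∪ {m})
    (hunion (hunion (h𝒦.small _ hP) (h𝒦.small _ hN₀)) hm)
    (hsum (hsum hA hB) hB)
    (Sum.elim (Sum.elim (fun t : A => u t) (fun t : B => u t)) r)
  have hPN' : P ⊆ N' := fun x hx => hsub (Or.inl (Or.inl hx))
  have hN₀N' : N₀ ⊆ N' := fun x hx => hsub (Or.inl (Or.inr hx))
  have hmN' : m ∈ N' := hsub (Or.inr rfl)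
  have hAN' : ∀ t ∈ A, u t • N' = N' := fun t ht => hinv (Sum.inl (Sum.inl ⟨t, ht⟩))
  have hBN' : ∀ t : B, u t • N' = N' := fun t => hinv (Sum.inl (Sum.inr t))
  have hrN' : ∀ t : B, r t • N' = N' := fun t => hinv (Sum.inr t)
  have hrN₀ : ∀ t, r t • N₀ ⊆ N' := fun t => by
    rw [← hrN' t]; exact Set.smul_set_mono hN₀N'
  -- The new domain contains every `r t • N₀` and `u` is kept on `N'`, so whether this is an
  -- extension problem is now decided for good.
  by_cases hcond : N₀ ⊆ N₁ ∧ (∀ t : B, (u t * r t) • N₀ = N₀) ∧ (∀ t, s t • N₁ = N₁) ∧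
        (∀ t : B, ∀ x ∈ N₀, s t • x = (u t * r t) • x)
  · obtain ⟨h₀₁, hγ₀, hs₁, hsγ⟩ := hcond
    obtain ⟨N₃, hN₃, α, γ₃, hN'N₃, hαN₃, hα₀, hγ₃, hγ₃α⟩ :=
      h𝒦.amalgamate hB N₀ hN₀ N' hN' N₁ hN₁ hN₀N' h₀₁ (fun t => u t * r t) s hγ₀
        (fun t => by rw [mul_smul, hrN', hBN']) hs₁ hsγ
    -- Amalgamation prescribes the translated entry `u' t * r t`, hence the factor `(r t)⁻¹`. Since
    -- `r t` preserves `N'`, `u'` still agrees with `u` there.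
    let u' : W → G := fun t => if h : t ∈ B then γ₃ ⟨t, h⟩ * (r ⟨t, h⟩)⁻¹ else u t
    have hu'B : ∀ t : B, u' t = γ₃ t * (r t)⁻¹ := fun t => dif_pos t.2
    have hu'r : ∀ t : B, u' t * r t = γ₃ t := fun t => by rw [hu'B]; group
    have hu'P : ∀ t, ∀ x ∈ N', u' t • x = u t • x := by
      intro t x hx
      by_cases ht : t ∈ B
      · rw [hu'B ⟨t, ht⟩, mul_smul, hγ₃ _ _ ?_, mul_smul, smul_inv_smul]
        rw [← Set.mem_smul_set_iff_inv_smul_mem, hrN']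
        exact hx
      · simp only [u', dif_neg ht]
    obtain ⟨N, hN, hN₃N, hNinv⟩ := h𝒦.exists_invariant_superset hM (h𝒦.small _ hN₃)
      (hsum hA hB) (Sum.elim (fun t : A => u' t) r)
    refine ⟨N, hN, u', hPN'.trans (hN'N₃.trans hN₃N), hN₃N (hN'N₃ hmN'),
      fun t x hx => hu'P t x (hPN' hx), fun t ht => hNinv (Sum.inl ⟨t, ht⟩),
      fun t => (hrN₀ t).trans (hN'N₃.trans hN₃N), fun _ _ _ _ => ⟨α, hα₀, fun t x hx => ⟨?_, ?_⟩⟩⟩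
    · have : r t • N = N := hNinv (Sum.inr t)
      rw [← this, Set.smul_mem_smul_set_iff]
      exact hN₃N (hαN₃ ⟨x, hx, rfl⟩)
    · rw [hu'r]; exact hγ₃α t x hx
  · exact ⟨N', hN', u, hPN', hmN', fun _ _ _ => rfl, hAN', hrN₀,
      fun h₁ h₂ h₃ h₄ => (hcond ⟨h₁, h₂, h₃, h₄⟩).elim⟩

/-- There is a family of elements of `G` indexed by `M` all of whose initial segments remain generic
after arbitrary right translation of the entries by elements of a given set of size at most
`#M`. -/
theorem exists_generic_family (h𝒦 : AmalgamationSystem G 𝒦) (hM : ℵ₀ < #M)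
    (hpow : #M ^< #M = #M) [LinearOrder M] [WellFoundedLT M]
    (hord : ord #M = Ordinal.type (α := M) (· < ·)) {R : Set G} (hR : #R ≤ #M)
    (hRne : R.Nonempty) :
    ∃ g : M → G, ∀ (k : M) (r : Set.Iic k → G), (∀ t, r t ∈ R) →
      IsGenericTuple 𝒦 (fun t : Set.Iic k => g t * r t) := by
  classical
  obtain ⟨S, hS, hdense⟩ := h𝒦.exists_dense_subset hM hpow
  obtain ⟨N', hN', -⟩ := h𝒦.exists_superset ∅ (by simpa using bot_lt_of_lt hM)
  obtain ⟨s', hs', -⟩ := hdense N' hN' 1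
  have hMne : Nonempty M := mk_ne_zero_iff.1 (ne_bot_of_gt hM)
  have hIic := fun i : M => mk_Iic_lt i hord hM.le
  -- The tasks: an initial segment, translations from `R`, and an extension problem with maps from
  -- the dense set `S`. As each is settled when treated, once is enough, and a surjection from `M`
  -- suffices.
  let Q := Σ k : M, ((Set.Iic k → R) × (Set.Iic k → S)) × 𝒦 × 𝒦
  have hQ : #Q ≤ #M := mk_sigma_le_of_le hM.le le_rfl fun k =>
    mk_prod_le_of_le hM.le
      (mk_prod_le_of_le hM.le (mk_arrow_le_of_powerlt hpow (hIic k) hR)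
        (mk_arrow_le_of_powerlt hpow (hIic k) hS))
      (mk_prod_le_of_le hM.le (h𝒦.mk_le hM hpow) (h𝒦.mk_le hM hpow))
  have hQne : Nonempty Q := ⟨⟨Classical.arbitrary M,
    (fun _ => ⟨_, hRne.some_mem⟩, fun _ => ⟨s', hs'⟩), ⟨N', hN'⟩, ⟨N', hN'⟩⟩⟩
  obtain ⟨e⟩ := Cardinal.le_def _ _ |>.1 hQ
  obtain ⟨ρ, hρ⟩ : ∃ ρ : M → Q, Function.Surjective ρ :=
    ⟨Function.invFun e, Function.invFun_surjective e.injective⟩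
  let Rel : ∀ i : M, (Set.Iio i → Set M × (M → G)) → Set M × (M → G) → Prop := fun i F p =>
    p.1 ∈ 𝒦 ∧ (∀ j, (F j).1 ⊆ p.1) ∧ (∀ j t, ∀ x ∈ (F j).1, p.2 t • x = (F j).2 t • x) ∧
    i ∈ p.1 ∧ (∀ t ≤ i, p.2 t • p.1 = p.1) ∧
    (∀ t, ((ρ i).2.1.1 t : G) • ((ρ i).2.2.1 : Set M) ⊆ p.1) ∧
    (((ρ i).2.2.1 : Set M) ⊆ (ρ i).2.2.2 →
      (∀ t : Set.Iic (ρ i).1, (p.2 t * (ρ i).2.1.1 t) • ((ρ i).2.2.1 : Set M) = (ρ i).2.2.1) →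
      (∀ t, ((ρ i).2.1.2 t : G) • ((ρ i).2.2.2 : Set M) = (ρ i).2.2.2) →
      (∀ t : Set.Iic (ρ i).1, ∀ x ∈ ((ρ i).2.2.1 : Set M),
        ((ρ i).2.1.2 t : G) • x = (p.2 t * (ρ i).2.1.1 t) • x) →
      ∃ α : G, (∀ x ∈ ((ρ i).2.2.1 : Set M), α • x = x) ∧
        ∀ t : Set.Iic (ρ i).1, ∀ x ∈ ((ρ i).2.2.2 : Set M),
          ((ρ i).2.1.1 t : G) • α • x ∈ p.1 ∧
          (p.2 t * (ρ i).2.1.1 t) • α • x = α • ((ρ i).2.1.2 t : G) • x)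
  obtain ⟨F, hF⟩ := exists_transfinite_choice Rel (by
    intro i F hF
    obtain ⟨P, hP, hFP, -, u, hu⟩ := h𝒦.exists_glue_below (ι := Set.Iio i) (mk_Iio_lt i hord)
      (N := fun j => (F j).1) (f := fun j => (F j).2) (fun j => (hF j).1)
      (fun a b hab => by
        rcases hab.eq_or_lt with rfl | hlt
        · exact le_rfl
        · exact (hF b).2.1 ⟨a, hlt⟩)
      (fun a b hab t x hx => by
        rcases hab.eq_or_lt with rfl | hlt
        · rfl
        · exact (hF b).2.2.1 ⟨a, hlt⟩ t x hx)
    obtain ⟨N, hN, u', hPN, hiN, hu', hA, hr, hmeet⟩ := h𝒦.exists_generic_step hM hP u i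
      (hIic i) (hIic (ρ i).1) (fun t => ((ρ i).2.1.1 t : G)) (fun t => ((ρ i).2.1.2 t : G))
      (ρ i).2.2.1.2 (ρ i).2.2.2.2
    exact ⟨(N, u'), hN, fun j => (hFP j).trans hPN,
      fun j t x hx => (hu' t x (hFP j hx)).trans (hu j t x hx), hiN, hA, hr, hmeet⟩)
  have hmono : Monotone fun i => (F i).1 := fun a b hab => by
    rcases hab.eq_or_lt with rfl | hlt
    · exact le_rfl
    · exact (hF b).2.1 ⟨a, hlt⟩
  have hg := fun t => h𝒦.glue (fun i => (F i).1) (fun i => (F i).2 t) hmono (fun i => (hF i).1)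
    (fun a b hab x hx => by
        rcases hab.eq_or_lt with rfl | hlt
        · rfl
        · exact (hF b).2.2.1 ⟨a, hlt⟩ t x hx)
    -- Surjectivity of the limit: from stage `t` on, the approximations to the entry `t` permute
    -- their domains, and these exhaust `M`.
    (Or.inr ⟨fun x => ⟨x, (hF x).2.2.2.1⟩, fun x => ⟨max x t, by
      rw [(hF (max x t)).2.2.2.2.1 t (le_max_right _ _)]
      exact hmono (le_max_left x t) (hF x).2.2.2.1⟩⟩)
  choose g hg using hg
  refine ⟨g, fun k r hr N₀ hN₀ N₁ hN₁ h₀₁ hγ₀ η hη₁ hηγ => ?_⟩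
  choose s hsS hs using fun t : Set.Iic k => hdense N₁ hN₁ (η t)
  obtain ⟨i, hi⟩ := hρ ⟨k, (fun t => ⟨r t, hr t⟩, fun t => ⟨s t, hsS t⟩), ⟨N₀, hN₀⟩, ⟨N₁, hN₁⟩⟩
  obtain ⟨-, -, -, -, -, hrN, hmeet⟩ := hF i
  rw [hi] at hrN hmeet
  have hgF : ∀ t : Set.Iic k, ∀ x, r t • x ∈ (F i).1 →
      (g t * r t) • x = ((F i).2 t * r t) • x := fun t x hx => by
    rw [mul_smul, mul_smul, hg t i _ hx]
  have hgF₀ : ∀ t : Set.Iic k, ∀ x ∈ N₀, (g t * r t) • x = ((F i).2 t * r t) • x :=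
    fun t x hx => hgF t x (hrN t ⟨x, hx, rfl⟩)
  obtain ⟨α, hα₀, hα⟩ := hmeet h₀₁
    (fun t => (Set.image_congr (hgF₀ t)).symm.trans (hγ₀ t))
    (fun t => (Set.image_congr (hs t)).trans (hη₁ t))
    (fun t x hx => (hs t x (h₀₁ hx)).trans ((hηγ t x hx).trans (hgF₀ t x hx)))
  refine ⟨α, hα₀, fun t x hx => ?_⟩
  obtain ⟨hmem, heq⟩ := hα t x hx
  rw [hgF t _ hmem, ← hs t x hx]
  exact heq

end AmalgamationSystem

/-! ### Translations and the diagonal argument -/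

namespace AmalgamationSystem

variable {G M : Type w} [Group G] [MulAction G M] {𝒦 : Set (Set M)}

/-- If no pointwise stabiliser of a member of the system is contained in `H`, a subgroup of index at
most `#M`, then at most `#M` right translations suffice to move every element of `G` into
`H ∩ G_N`, and into `G_N` but outside of `c i • H • (c i)⁻¹`, for all `N ∈ 𝒦` and all `i`. -/
theorem exists_translators (h𝒦 : AmalgamationSystem G 𝒦) (hM : ℵ₀ < #M)
    (hpow : #M ^< #M = #M) (H : Subgroup G) (hH : #(G ⧸ H) ≤ #M)
    (hstab : ∀ N ∈ 𝒦, ∃ g : G, (∀ x ∈ N, g • x = x) ∧ g ∉ H) (c : M → G) :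
    ∃ R : Set G, #R ≤ #M ∧ ∀ N ∈ 𝒦, ∀ g : G,
      (∃ r ∈ R, (∀ x ∈ N, (g * r) • x = x) ∧ g * r ∈ H) ∧
      ∀ i, ∃ r ∈ R, (∀ x ∈ N, (g * r) • x = x) ∧ (c i)⁻¹ * (g * r) * c i ∉ H := by
  classical
  have hcover : ∀ N : 𝒦, ∃ R : Set G, #R ≤ #M ∧
      ∀ g : G, ∃ r ∈ R, (∀ x ∈ (N : Set M), (g * r) • x = x) ∧ g * r ∈ H := by
    intro N
    -- If `r` has the same restriction to `N` and the same left coset of `H` as `g⁻¹`, then `g * r`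
    -- fixes `N` and lies in `H`. One `r` for each value of `φ` is enough.
    let φ : G → (↥(N : Set M) → M) × (G ⧸ H) := fun g => (fun x => g • (x : M), (g : G ⧸ H))
    let F : (↥(N : Set M) → M) × (G ⧸ H) → G := Function.invFun φ
    refine ⟨Set.range F, mk_range_le.trans (mk_prod_le_of_le hM.le
      (mk_arrow_le_of_powerlt hpow (h𝒦.small _ N.2) le_rfl) hH), fun g => ?_⟩
    have hF : φ (F (φ g⁻¹)) = φ g⁻¹ := Function.invFun_eq ⟨g⁻¹, rfl⟩
    refine ⟨F (φ g⁻¹), ⟨_, rfl⟩, fun x hx => ?_, ?_⟩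
    · have h₁ : F (φ g⁻¹) • x = g⁻¹ • x := congrFun (congrArg Prod.fst hF) ⟨x, hx⟩
      rw [mul_smul, h₁, smul_inv_smul]
    · have h₂ : ((F (φ g⁻¹) : G) : G ⧸ H) = (g⁻¹ : G) := congrArg Prod.snd hF
      have h₃ := QuotientGroup.eq.1 h₂.symm
      rwa [inv_inv] at h₃
  choose R hR hRg using hcover
  have hconj : ∀ (N : 𝒦) (i : M), ∃ a : G, (∀ x ∈ (N : Set M), a • x = x) ∧
      (c i)⁻¹ * a * c i ∉ H := by
    intro N i
    -- The stabiliser of `N` is conjugate by `c i` to that of `(c i)⁻¹ • N`, which is not contained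
    -- in `H` either.
    obtain ⟨b, hb, hbH⟩ := hstab _ (h𝒦.smul_mem (c i)⁻¹ _ N.2)
    refine ⟨c i * b * (c i)⁻¹, fun x hx => ?_, by simpa [mul_assoc] using hbH⟩
    rw [mul_smul, mul_smul, hb _ ⟨x, hx, rfl⟩, smul_inv_smul]
  choose a ha haH using hconj
  let T : (Σ N : 𝒦, R N × Option M) → G := fun p =>
    (p.2.1 : G) * p.2.2.elim 1 (fun i => a p.1 i)
  have hopt : #(Option M) ≤ #M := by
    rw [mk_option]; exact add_le_of_le hM.le le_rfl (one_le_aleph0.trans hM.le)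
  refine ⟨Set.range T, mk_range_le.trans (mk_sigma_le_of_le hM.le (h𝒦.mk_le hM hpow) fun N =>
    mk_prod_le_of_le hM.le (hR N) hopt), fun N hN g => ?_⟩
  obtain ⟨r, hr, hrN, hrH⟩ := hRg ⟨N, hN⟩ g
  have hT : r ∈ Set.range T := ⟨⟨⟨N, hN⟩, ⟨r, hr⟩, none⟩, by simp [T]⟩
  refine ⟨⟨r, hT, hrN, hrH⟩, fun i => ?_⟩
  -- If `g * r` falls into the forbidden conjugate of `H`, a further factor that fixes `N` and lies
  -- outside that conjugate moves it out.
  by_cases hci : (c i)⁻¹ * (g * r) * c i ∈ H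
  · refine ⟨r * a ⟨N, hN⟩ i, ⟨⟨⟨N, hN⟩, ⟨r, hr⟩, some i⟩, by simp [T]⟩, fun x hx => ?_, ?_⟩
    · rw [← mul_assoc, mul_smul, ha ⟨N, hN⟩ i x hx, hrN x hx]
    · have : (c i)⁻¹ * (g * (r * a ⟨N, hN⟩ i)) * c i =
          ((c i)⁻¹ * (g * r) * c i) * ((c i)⁻¹ * a ⟨N, hN⟩ i * c i) := by group
      rw [this, Subgroup.mul_mem_cancel_left _ hci]
      exact haH _ _
  · exact ⟨r, hT, hrN, hci⟩

/-- A stage in the construction of an element of `G` conjugating each entry of one tuple to the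
corresponding entry of another. -/
structure Stage (G M : Type w) where
  /-- The set on which the element under construction is already determined. -/
  dom : Set M
  /-- An element of `G` with the right values on `dom`. -/
  map : G
  /-- The entry added to the first tuple at this stage. -/
  x : G
  /-- The entry added to the second tuple at this stage. -/
  y : G

/-- A subgroup of index at most `#M` contains the pointwise stabiliser of a member of the system. -/
theorem exists_stabilizer_le (h𝒦 : AmalgamationSystem G 𝒦) [FaithfulSMul G M] (hM : ℵ₀ < #M)
    (hpow : #M ^< #M = #M) (H : Subgroup G) (hH : #(G ⧸ H) ≤ #M) :
    ∃ N ∈ 𝒦, ∀ g : G, (∀ x ∈ N, g • x = x) → g ∈ H := by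
  classical
  by_contra! hstab
  obtain ⟨_, _, hord⟩ := exists_ord_eq_type_lt M
  have hMne : Nonempty M := mk_ne_zero_iff.1 (ne_bot_of_gt hM)
  obtain ⟨c, hc⟩ : ∃ c : M → G, ∀ g : G, ∃ i, (c i)⁻¹ * g ∈ H := by
    obtain ⟨e⟩ := Cardinal.le_def _ _ |>.1 hH
    refine ⟨fun i => (Function.invFun e i).out, fun g => ⟨e g, ?_⟩⟩
    beta_reduce
    rw [← QuotientGroup.eq, Function.leftInverse_invFun e.injective, QuotientGroup.out_eq']
  obtain ⟨R, hR, htrans⟩ := h𝒦.exists_translators hM hpow H hH hstab c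
  have hRne : R.Nonempty := by
    obtain ⟨N, hN, -⟩ := h𝒦.exists_superset ∅ (by simpa using bot_lt_of_lt hM)
    obtain ⟨⟨r, hr, -⟩, -⟩ := htrans N hN 1
    exact ⟨r, hr⟩
  obtain ⟨g, hg⟩ := h𝒦.exists_generic_family hM hpow hord hR hRne
  -- The point `i` enters both domain and range, so the limit map is a bijection of `M`; all entries
  -- chosen so far stay intertwined on each later domain.
  let Rel : ∀ i : M, (Set.Iio i → Stage G M) → Stage G M → Prop := fun i F p =>
    p.dom ∈ 𝒦 ∧ (∀ j, (F j).dom ⊆ p.dom) ∧ (∀ j, ∀ z ∈ (F j).dom, p.map • z = (F j).map • z) ∧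
    i ∈ p.dom ∧ i ∈ p.map • p.dom ∧
    p.x ∈ H ∧ (c i)⁻¹ * p.y * c i ∉ H ∧ (g i)⁻¹ * p.x ∈ R ∧ (g i)⁻¹ * p.y ∈ R ∧
    (p.x • p.dom = p.dom ∧ ∀ z ∈ p.dom, p.map • p.x • z = p.y • p.map • z) ∧
    ∀ j, (F j).x • p.dom = p.dom ∧ ∀ z ∈ p.dom, p.map • (F j).x • z = (F j).y • p.map • z
  have : Nonempty (Stage G M) := ⟨⟨∅, 1, 1, 1⟩⟩
  obtain ⟨F, hF⟩ := exists_transfinite_choice Rel (by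
    intro i F hF
    have hmono : Monotone fun j => (F j).dom := fun a b hab => by
      rcases hab.eq_or_lt with rfl | hlt
      · exact le_rfl
      · exact (hF b).2.1 ⟨a, hlt⟩
    obtain ⟨P, hP, hFP, hPF, f', hf'⟩ := h𝒦.exists_glue_below (ι := Set.Iio i)
      (mk_Iio_lt i hord) (N := fun j => (F j).dom) (f := fun j (_ : Unit) => (F j).map)
      (fun j => (hF j).1) hmono
      (fun a b hab _ z hz => by
        rcases hab.eq_or_lt with rfl | hlt
        · rfl
        · exact (hF b).2.2.1 ⟨a, hlt⟩ z hz)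
    obtain ⟨f, hf⟩ : ∃ f : G, ∀ j, ∀ z ∈ (F j).dom, f • z = (F j).map • z :=
      ⟨f' (), fun j => hf' j ()⟩
    have hxdom : ∀ j l, j ≤ l → (F j).x • (F l).dom = (F l).dom ∧
        ∀ z ∈ (F l).dom, (F l).map • (F j).x • z = (F j).y • (F l).map • z := by
      intro j l hjl
      rcases hjl.eq_or_lt with rfl | hlt
      · exact (hF j).2.2.2.2.2.2.2.2.2.1
      · exact (hF l).2.2.2.2.2.2.2.2.2.2 ⟨j, hlt⟩
    have hxP : ∀ j, (F j).x • P = P := by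
      intro j
      ext z
      constructor
      · rintro ⟨z, hz, rfl⟩
        obtain ⟨l, hjl, hzl⟩ := hPF j z hz
        apply hFP l
        rw [← (hxdom j l hjl).1]
        exact ⟨z, hzl, rfl⟩
      · intro hz
        obtain ⟨l, hjl, hzl⟩ := hPF j z hz
        exact Set.smul_set_mono (hFP l) ((hxdom j l hjl).1.symm ▸ hzl)
    have hxy : ∀ j, ∀ z ∈ P, f • (F j).x • z = (F j).y • f • z := by
      intro j z hz
      obtain ⟨l, hjl, hzl⟩ := hPF j z hz
      rw [hf l z hzl, hf l _ ?_, (hxdom j l hjl).2 z hzl]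
      rw [← (hxdom j l hjl).1]
      exact ⟨z, hzl, rfl⟩
    -- The new entries `g i * r` and `g i * r'` fix `P` and `f • P` pointwise, so `f` intertwines
    -- them trivially.
    obtain ⟨⟨r, hrR, hrP, hrH⟩, -⟩ := htrans P hP (g i)
    obtain ⟨r', hr'R, hr'P, hr'H⟩ := (htrans (f • P) (h𝒦.smul_mem f P hP) (g i)).2 i
    let X : Set.Iic i → G := fun t => if h : (t : M) < i then (F ⟨t, h⟩).x else g i * r
    let Y : Set.Iic i → G := fun t => if h : (t : M) < i then (F ⟨t, h⟩).y else g i * r'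
    have hXlt : ∀ j : Set.Iio i, X ⟨j, le_of_lt j.2⟩ = (F j).x := fun j => dif_pos j.2
    have hYlt : ∀ j : Set.Iio i, Y ⟨j, le_of_lt j.2⟩ = (F j).y := fun j => dif_pos j.2
    have hXi : X ⟨i, le_rfl⟩ = g i * r := dif_neg (lt_irrefl i)
    have hYi : Y ⟨i, le_rfl⟩ = g i * r' := dif_neg (lt_irrefl i)
    have hcases : ∀ t : Set.Iic i, (∃ j : Set.Iio i, t = ⟨j, le_of_lt j.2⟩) ∨ t = ⟨i, le_rfl⟩ := by
      rintro ⟨t, ht⟩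
      rcases eq_or_lt_of_le (Set.mem_Iic.1 ht) with rfl | hlt
      · exact Or.inr rfl
      · exact Or.inl ⟨⟨t, hlt⟩, rfl⟩
    have hgen : ∀ Z : Set.Iic i → G, (∀ t : Set.Iic i, (g t)⁻¹ * Z t ∈ R) → IsGenericTuple 𝒦 Z := by
      intro Z hZ
      simpa using hg i (fun t => (g t)⁻¹ * Z t) hZ
    have hXgen : IsGenericTuple 𝒦 X := hgen X fun t => by
      rcases hcases t with ⟨j, rfl⟩ | rfl
      · rw [hXlt]; exact (hF j).2.2.2.2.2.2.2.1
      · rw [hXi]; simpa using hrR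
    have hYgen : IsGenericTuple 𝒦 Y := hgen Y fun t => by
      rcases hcases t with ⟨j, rfl⟩ | rfl
      · rw [hYlt]; exact (hF j).2.2.2.2.2.2.2.2.1
      · rw [hYi]; simpa using hr'R
    obtain ⟨N, hN, hPN, hiN, hXN, k, hik, hkf, hkXY⟩ := h𝒦.exists_extend_intertwiner_both hM
      (mk_Iic_lt i hord hM.le) hXgen hYgen hP
      (fun t => by
        rcases hcases t with ⟨j, rfl⟩ | rfl
        · rw [hXlt]; exact hxP j
        · rw [hXi]
          exact (Set.image_congr hrP).trans (Set.image_id' P))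
      (f := f)
      (fun t z hz => by
        rcases hcases t with ⟨j, rfl⟩ | rfl
        · rw [hXlt, hYlt]; exact hxy j z hz
        · rw [hXi, hYi, hrP z hz, hr'P _ ⟨z, hz, rfl⟩]) i
    refine ⟨⟨N, k, g i * r, g i * r'⟩, hN, fun j => (hFP j).trans hPN,
      fun j z hz => (hkf z (hFP j hz)).trans (hf j z hz), hiN, hik, hrH, hr'H, by simpa using hrR,
      by simpa using hr'R, ⟨hXi ▸ hXN ⟨i, le_rfl⟩, ?_⟩, fun j => ⟨?_, ?_⟩⟩
    · have := hkXY ⟨i, le_rfl⟩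
      rwa [hXi, hYi] at this
    · have := hXN ⟨j, le_of_lt j.2⟩
      rwa [hXlt] at this
    · have := hkXY ⟨j, le_of_lt j.2⟩
      rwa [hXlt, hYlt] at this)
  have hmono : Monotone fun i => (F i).dom := fun a b hab => by
    rcases hab.eq_or_lt with rfl | hlt
    · exact le_rfl
    · exact (hF b).2.1 ⟨a, hlt⟩
  obtain ⟨f, hf⟩ := h𝒦.glue (fun i => (F i).dom) (fun i => (F i).map) hmono (fun i => (hF i).1)
    (fun a b hab x hx => by
        rcases hab.eq_or_lt with rfl | hlt
        · rfl
        · exact (hF b).2.2.1 ⟨a, hlt⟩ x hx)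
    (Or.inr ⟨fun x => ⟨x, (hF x).2.2.2.1⟩, fun x => ⟨x, (hF x).2.2.2.2.1⟩⟩)
  obtain ⟨i, hi⟩ := hc f
  have hconj : f * (F i).x = (F i).y * f := by
    refine FaithfulSMul.eq_of_smul_eq_smul (α := M) fun z => ?_
    let l := max i z
    have hzl : z ∈ (F l).dom := hmono (le_max_right i z) (hF z).2.2.2.1
    have hl : (F i).x • (F l).dom = (F l).dom ∧
        ∀ z ∈ (F l).dom, (F l).map • (F i).x • z = (F i).y • (F l).map • z := by
      rcases (le_max_left i z).eq_or_lt with heq | hlt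
      · have := (hF i).2.2.2.2.2.2.2.2.2.1
        change i = l at heq
        rwa [← heq]
      · exact (hF l).2.2.2.2.2.2.2.2.2.2 ⟨i, hlt⟩
    rw [mul_smul, mul_smul, hf l z hzl, hf l _ ?_, hl.2 z hzl]
    rw [← hl.1]
    exact ⟨z, hzl, rfl⟩
  refine (hF i).2.2.2.2.2.2.1 ?_
  have hy : (c i)⁻¹ * (F i).y * c i = ((c i)⁻¹ * f) * (F i).x * ((c i)⁻¹ * f)⁻¹ := by
    have : (F i).y = f * (F i).x * f⁻¹ := by rw [hconj]; group
    rw [this]; group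
  rw [hy]
  exact H.mul_mem (H.mul_mem hi (hF i).2.2.2.2.2.1) (H.inv_mem hi)

end AmalgamationSystem

/-! ### Automorphisms of structures and gluing along chains -/

/-- The tautological action of the automorphism group of a structure. -/
instance FirstOrder.Language.Equiv.autMulAction {L : FirstOrder.Language.{u, v}} {M : Type w}
    [L.Structure M] : MulAction (M ≃[L] M) M where
  smul g x := g x
  one_smul _ := rfl
  mul_smul _ _ _ := rfl

instance FirstOrder.Language.Equiv.autFaithfulSMul {L : FirstOrder.Language.{u, v}} {M : Type w}
    [L.Structure M] : FaithfulSMul (M ≃[L] M) M where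
  eq_of_smul_eq_smul h := FirstOrder.Language.Equiv.ext h

namespace FirstOrder.Language.Substructure

variable {L : FirstOrder.Language.{u, v}} {M : Type w} [L.Structure M]

/-- The restriction of an automorphism `g` of `M` to a substructure invariant under `g`. -/
def restrictAut (g : M ≃[L] M) (N : L.Substructure M) (h : g • (N : Set M) = N) : N ≃[L] N where
  toFun x := ⟨g x, by
    have : g • (x : M) ∈ g • (N : Set M) := ⟨x, x.2, rfl⟩
    rwa [h] at this⟩
  invFun y := ⟨g⁻¹ • (y : M), by
    have : g⁻¹ • (y : M) ∈ (N : Set M) := by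
      rw [← Set.mem_smul_set_iff_inv_smul_mem, h]
      exact y.2
    exact this⟩
  left_inv x := Subtype.ext (inv_smul_smul g (x : M))
  right_inv y := Subtype.ext (smul_inv_smul g (y : M))
  map_fun' f x := Subtype.ext (g.map_fun f _)
  map_rel' r x := g.map_rel r _

theorem coe_restrictAut (g : M ≃[L] M) (N : L.Substructure M) (h : g • (N : Set M) = N) (x : N) :
    (restrictAut g N h x : M) = g • (x : M) := rfl

/-- A coherent family of automorphisms on a chain of substructures glues to an embedding of its
union. -/
theorem exists_glued_embedding {ι : Type*} [LinearOrder ι] [Nonempty ι]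
    (N : ι → L.Substructure M) (f : ι → (M ≃[L] M)) (hmono : Monotone N)
    (hf : ∀ i j, i ≤ j → ∀ x ∈ N i, f j • x = f i • x) (S : L.Substructure M)
    (hS : ∀ x, x ∈ S ↔ ∃ i, x ∈ N i) :
    ∃ e : S ↪[L] M, ∀ i, ∀ x : S, (x : M) ∈ N i → e x = f i • (x : M) := by
  choose k hk using fun x : S => (hS x).1 x.2
  let F : S → M := fun x => f (k x) • (x : M)
  have hF : ∀ i, ∀ x : S, (x : M) ∈ N i → F x = f i • (x : M) := by
    intro i x hx
    rcases le_total i (k x) with h | h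
    · exact hf _ _ h _ hx
    · exact (hf _ _ h _ (hk x)).symm
  have htuple : ∀ {n : ℕ} (x : Fin n → S), ∃ i, ∀ a, (x a : M) ∈ N i := by
    intro n x
    obtain ⟨i, hi⟩ := Finite.exists_le fun a => k (x a)
    exact ⟨i, fun a => hmono (hi a) (hk (x a))⟩
  have hcomp : ∀ {n : ℕ} (x : Fin n → S) i, (∀ a, (x a : M) ∈ N i) →
      F ∘ x = f i ∘ fun a => (x a : M) := fun x i hi => funext fun a => hF i _ (hi a)
  refine ⟨⟨⟨F, fun x y hxy => ?_⟩, fun {n} φ x => ?_, fun {n} φ x => ?_⟩, hF⟩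
  · have hx := hmono (le_max_left (k x) (k y)) (hk x)
    have hy := hmono (le_max_right (k x) (k y)) (hk y)
    rw [hF _ x hx, hF _ y hy] at hxy
    exact Subtype.ext (smul_left_cancel _ hxy)
  · obtain ⟨i, hi⟩ := htuple x
    change F _ = Structure.funMap φ (F ∘ x)
    rw [hcomp x i hi, hF i _ ((N i).fun_mem φ _ hi)]
    exact (f i).map_fun φ _
  · obtain ⟨i, hi⟩ := htuple x
    change Structure.RelMap φ (F ∘ x) ↔ _
    rw [hcomp x i hi]
    exact (f i).map_rel φ _

end FirstOrder.Language.Substructure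

/-! ### Small strong submodels as an amalgamation system -/

namespace AbstractElementaryClass

open FirstOrder.Language

variable {L : FirstOrder.Language.{u, v}} (K : AbstractElementaryClass.{u, v, w} L)
variable {M : Type w} [L.Structure M]

theorem lsNumber_spec : ℵ₀ ≤ K.lsNumber ∧ ∀ {M : Type w} [L.Structure M], K.mem M →
    ∀ A : Set M, ∃ N : L.Substructure M, K.strong N ∧ A ⊆ N ∧ #N ≤ #A + K.lsNumber :=
  csInf_mem (s := {μ : Cardinal.{w} | ℵ₀ ≤ μ ∧ ∀ {M : Type w} [L.Structure M], K.mem M →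
    ∀ A : Set M, ∃ N : L.Substructure M, K.strong N ∧ A ⊆ N ∧ #N ≤ #A + μ}) K.exists_ls

theorem map_mem_smallStrong (g : M ≃[L] M) {N : L.Substructure M} (hN : N ∈ K.smallStrong M) :
    N.map g.toHom ∈ K.smallStrong M :=
  ⟨K.strong_iso g N hN.1, (mk_image_le (f := g) (s := (N : Set M))).trans_lt hN.2⟩

theorem iSup_mem_smallStrong (hreg : (#M).IsRegular) {ι : Type w} [LinearOrder ι]
    [WellFoundedLT ι] [Nonempty ι] (hι : #ι < #M) {N : ι → L.Substructure M} (hmono : Monotone N)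
    (hN : ∀ i, N i ∈ K.smallStrong M) {S : L.Substructure M}
    (hS : (S : Set M) = ⋃ i, (N i : Set M)) : S ∈ K.smallStrong M := by
  refine ⟨K.chain_smooth N hmono (fun i => (hN i).1) S hS, ?_⟩
  change #(S : Set M) < #M
  rw [hS]
  exact (card_iUnion_lt_iff_forall_of_isRegular hreg hι).2 fun i => (hN i).2

theorem strongIn_of_le {P N : L.Substructure M} (h : P ≤ N) (hP : K.strong P) (hN : K.strong N) :
    K.StrongIn P N :=
  ⟨h, K.coherence P N h hP hN⟩

/-- For a short chain, regularity keeps the union and its image small, smoothness makes them strong,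
and homogeneity extends the glued isomorphism. If domains and images exhaust `M`, the glued map is
itself an automorphism. -/
theorem exists_glued_aut (hreg : (#M).IsRegular) (hhom : K.IsHomogeneousModel M) {ι : Type w}
    [LinearOrder ι] [WellFoundedLT ι] [Nonempty ι] (N : ι → L.Substructure M)
    (f : ι → (M ≃[L] M)) (hmono : Monotone N) (hN : ∀ i, N i ∈ K.smallStrong M)
    (hf : ∀ i j, i ≤ j → ∀ x ∈ N i, f j • x = f i • x)
    (h : #ι < #M ∨ (∀ x, ∃ i, x ∈ N i) ∧ ∀ x, ∃ i, x ∈ f i • (N i : Set M)) :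
    ∃ g : M ≃[L] M, ∀ i, ∀ x ∈ N i, g • x = f i • x := by
  have hmem : ∀ x, x ∈ ⨆ i, N i ↔ ∃ i, x ∈ N i := fun x =>
    Substructure.mem_iSup_of_directed hmono.directed_le
  obtain ⟨e, he⟩ := Substructure.exists_glued_embedding N f hmono hf _ hmem
  have hle : ∀ i, N i ≤ ⨆ i, N i := le_iSup N
  rcases h with hι | ⟨hdom, hrange⟩
  · have hS := K.iSup_mem_smallStrong hreg hι hmono hN (S := ⨆ i, N i) (by
      ext x; rw [Set.mem_iUnion]; exact hmem x)
    have hT := K.iSup_mem_smallStrong hreg hι (N := fun i => (N i).map (f i).toHom)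
      (fun i j hij => by
        rintro _ ⟨x, hx, rfl⟩
        exact ⟨x, hmono hij hx, hf i j hij x hx⟩)
      (fun i => K.map_mem_smallStrong (f i) (hN i)) (S := e.toHom.range) (by
        ext y
        rw [Set.mem_iUnion]
        constructor
        · rintro ⟨x, rfl⟩
          obtain ⟨i, hi⟩ := (hmem x).1 x.2
          exact ⟨i, x, hi, (he i x hi).symm⟩
        · rintro ⟨i, x, hx, rfl⟩
          exact ⟨⟨x, hle i hx⟩, he i ⟨x, hle i hx⟩ hx⟩)
    obtain ⟨g, hg⟩ := hhom _ hS _ hT e.equivRange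
    exact ⟨g, fun i x hx => (hg ⟨x, hle i hx⟩).trans (he i ⟨x, hle i hx⟩ hx)⟩
  · have htop : ∀ x, x ∈ ⨆ i, N i := fun x => (hmem x).2 (hdom x)
    have hbij : Function.Bijective fun x : M => e ⟨x, htop x⟩ := by
      refine ⟨fun x y hxy => congrArg Subtype.val (e.injective hxy), fun y => ?_⟩
      obtain ⟨i, x, hx, rfl⟩ := hrange y
      exact ⟨x, he i ⟨x, htop x⟩ hx⟩
    exact ⟨⟨Equiv.ofBijective _ hbij, fun φ x => e.map_fun φ fun a => ⟨x a, htop _⟩,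
      fun φ x => e.map_rel φ fun a => ⟨x a, htop _⟩⟩, fun i x hx => he i ⟨x, htop x⟩ hx⟩

/-- The small strong submodels of a homogeneous model with strong amalgamation form an amalgamation
system for its automorphism group. -/
theorem amalgamationSystem_smallStrong (hM : K.mem M) (hreg : (#M).IsRegular)
    (hLS : K.lsNumber < #M) (hhom : K.IsHomogeneousModel M)
    (hsap : K.IsStrongAmalgamationClass M) :
    AmalgamationSystem (M ≃[L] M)
      ((fun N : L.Substructure M => (N : Set M)) '' K.smallStrong M) where
  small := by
    rintro _ ⟨N, hN, rfl⟩
    exact hN.2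
  smul_mem := by
    rintro g _ ⟨N, hN, rfl⟩
    exact ⟨_, K.map_mem_smallStrong g hN, rfl⟩
  exists_superset := by
    intro A hA
    obtain ⟨N, hN, hAN, hcard⟩ := K.lsNumber_spec.2 hM A
    exact ⟨N, ⟨N, ⟨hN, hcard.trans_lt (add_lt_of_lt hreg.aleph0_le hA hLS)⟩, rfl⟩, hAN⟩
  iUnion_mem := by
    intro ι _ _ _ N hι hmono hN
    choose P hP hPN using hN
    obtain rfl : (fun i => (P i : Set M)) = N := funext hPN
    have hPmono : Monotone P := hmono
    have hcoe : ((⨆ i, P i : L.Substructure M) : Set M) = ⋃ i, (P i : Set M) := by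
      ext x
      rw [Set.mem_iUnion]
      exact Substructure.mem_iSup_of_directed hPmono.directed_le
    exact ⟨_, K.iSup_mem_smallStrong hreg hι hPmono hP hcoe, hcoe⟩
  glue := by
    intro ι _ _ _ N f hmono hN hf h
    choose P hP hPN using hN
    obtain rfl : (fun i => (P i : Set M)) = N := funext hPN
    exact K.exists_glued_aut hreg hhom P f hmono hP hf h
  amalgamate := by
    rintro I hI _ ⟨N₀, hN₀, rfl⟩ _ ⟨N₁, hN₁, rfl⟩ _ ⟨N₂, hN₂, rfl⟩ h₀₁ h₀₂ γ₁ γ₂ hγ₁₀ hγ₁ hγ₂ hγ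
    obtain ⟨N₃, hN₃, α₁, hα₁, α₂, hα₂, hs₁, hs₂, γ₃, h₁, h₂⟩ :=
      hsap I hI N₀ hN₀ (fun i => Substructure.restrictAut (γ₁ i) N₀ (hγ₁₀ i)) N₁ hN₁ N₂ hN₂
        (K.strongIn_of_le h₀₁ hN₀.1 hN₁.1) (K.strongIn_of_le h₀₂ hN₀.1 hN₂.1)
        (fun i => Substructure.restrictAut (γ₁ i) N₁ (hγ₁ i))
        (fun i => Substructure.restrictAut (γ₂ i) N₂ (hγ₂ i))
        ⟨h₀₁, fun i x y hxy => by
          rw [Substructure.coe_restrictAut, Substructure.coe_restrictAut, hxy]⟩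
        ⟨h₀₂, fun i x y hxy => by
          rw [Substructure.coe_restrictAut, Substructure.coe_restrictAut, hxy, hγ i x x.2]⟩
    -- Homogeneity lifts the amalgamated maps to `M`; conjugation by `α₁` then puts `N₁` back in
    -- place, leaving only `α₁⁻¹ * α₂` to move `N₂`.
    choose Γ hΓ using fun i => hhom N₃ hN₃ N₃ hN₃ (γ₃ i)
    have hm₁ : ∀ x ∈ N₁, α₁ • x ∈ N₃ := fun x hx => hs₁.1 ⟨x, hx, rfl⟩
    have hm₂ : ∀ x ∈ N₂, α₂ • x ∈ N₃ := fun x hx => hs₂.1 ⟨x, hx, rfl⟩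
    have hΓ₁ : ∀ i, ∀ x ∈ N₁, Γ i • α₁ • x = α₁ • γ₁ i • x := fun i x hx =>
      (hΓ i ⟨_, hm₁ x hx⟩).trans (h₁ i ⟨x, hx⟩ ⟨_, hm₁ x hx⟩ rfl)
    have hΓ₂ : ∀ i, ∀ x ∈ N₂, Γ i • α₂ • x = α₂ • γ₂ i • x := fun i x hx =>
      (hΓ i ⟨_, hm₂ x hx⟩).trans (h₂ i ⟨x, hx⟩ ⟨_, hm₂ x hx⟩ rfl)
    refine ⟨_, ⟨_, K.map_mem_smallStrong α₁⁻¹ hN₃, rfl⟩, α₁⁻¹ * α₂, fun i => α₁⁻¹ * Γ i * α₁,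
      fun x hx => ⟨α₁ • x, hm₁ x hx, inv_smul_smul α₁ x⟩, ?_, fun x hx => ?_, fun i x hx => ?_,
      fun i x hx => ?_⟩
    · rintro _ ⟨x, hx, rfl⟩
      exact ⟨α₂ • x, hm₂ x hx, rfl⟩
    · rw [mul_smul, inv_smul_eq_iff]
      exact (hα₂ x hx).trans (hα₁ x hx).symm
    · rw [mul_smul, mul_smul, hΓ₁ i x hx, inv_smul_smul]
    · simp only [mul_smul, smul_inv_smul]
      rw [hΓ₂ i x hx]

/-- A subgroup containing the pointwise stabiliser of a small strong submodel is open. -/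
theorem isOpen_of_autFixing_le {H : Subgroup (M ≃[L] M)} {A : L.Substructure M}
    (hA : A ∈ K.smallStrong M) (hAH : L.autFixing (A : Set M) ≤ H) :
    IsOpen[K.closureTopology M] (H : Set (M ≃[L] M)) := by
  -- Fixing the closure of `A` pointwise entails fixing `A`, so `H` is a union of cosets of a basic
  -- stabiliser.
  have hle : L.autFixing (K.cl (A : Set M)) ≤ H :=
    fun g hg => hAH fun x hx => hg x fun N _ hAN => hAN hx
  let _ := K.closureTopology M
  have hU : (H : Set (M ≃[L] M)) =
      ⋃ g ∈ H, {h | ∃ s ∈ L.autFixing (K.cl (A : Set M)), h = g * s} := by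
    ext h
    simp only [Set.mem_iUnion, SetLike.mem_coe]
    constructor
    · exact fun hh => ⟨h, hh, 1, Subgroup.one_mem _, (mul_one h).symm⟩
    · rintro ⟨g, hg, s, hs, rfl⟩
      exact H.mul_mem hg (hle hs)
  rw [hU]
  exact isOpen_biUnion fun g _ => TopologicalSpace.isOpen_generateFrom_of_mem ⟨A, hA.2, g, rfl⟩

end AbstractElementaryClass

theorem theorem4p1 {L : FirstOrder.Language.{u, v}} (K : AbstractElementaryClass.{u, v, w} L)
    (M : Type w) [L.Structure M] (κ : Cardinal.{w}) (hM : K.mem M) (hcard : #M = κ)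
    (hLS : K.lsNumber < κ) (hκ : κ ^< κ = κ) (hhom : K.IsHomogeneousModel M)
    (hsap : K.IsStrongAmalgamationClass M) :
    (∀ H : Subgroup (M ≃[L] M), #((M ≃[L] M) ⧸ H) ≤ κ →
      IsOpen[K.closureTopology M] (H : Set (M ≃[L] M)) ∧
      ∃ A ∈ K.smallStrong M, L.autFixing (A : Set M) ≤ H) ∧
    K.HasSmallIndexProperty M := by
  subst hcard
  have hω : ℵ₀ < #M := K.lsNumber_spec.1.trans_lt hLS
  have hsys := K.amalgamationSystem_smallStrong hM (isRegular_of_powerlt_self hω.le hκ) hLS hhom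
    hsap
  have key : ∀ H : Subgroup (M ≃[L] M), #((M ≃[L] M) ⧸ H) ≤ #M →
      ∃ A ∈ K.smallStrong M, L.autFixing (A : Set M) ≤ H := by
    intro H hH
    obtain ⟨_, ⟨A, hA, rfl⟩, hAH⟩ := hsys.exists_stabilizer_le hω hκ H hH
    exact ⟨A, hA, fun g hg => hAH g hg⟩
  refine ⟨fun H hH => ?_, fun H hH => ?_⟩
  · obtain ⟨A, hA, hAH⟩ := key H hH
    exact ⟨K.isOpen_of_autFixing_le hA hAH, A, hA, hAH⟩
  · obtain ⟨A, hA, hAH⟩ := key H hH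
    exact K.isOpen_of_autFixing_le hA hAH
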